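/- **Proposition C.1 (properties of the jump chain).** Let $K$ be a Markov kernel on a measurable space $\mathsf{X}$ whose diagonal $\{(x,x)\}$ is measurable in the product $\sigma$-algebra, and suppose $K$ is non-degenerate: $a(x) := K(x,\mathsf{X}\setminus\{x\}) > 0$ for all $x\in\mathsf{X}$. Let $(X_k)_{k\ge 1}$ be a Markov chain with kernel $K$ and arbitrary initial distribution. Define its jump chain $(\tilde X_k)_{k\ge 1}$ and holding times $(N_k)_{k\ge 1}$ recursively by $$\tilde X_k := X_{\bar N_{k-1}+1},\qquad N_k := \inf\{j\ge 1 : X_{\bar N_{k-1}+j+1}\ne \tilde X_k\},\qquad \bar N_k := \sum_{j=1}^k N_j,\quad \bar N_0 := 0 .$$ Almost surely all $N_k$ are finite (so these are well defined), and the following hold. 1. $(\tilde X_k)$ is a Markov chain with transition kernel $\tilde K(x,A) = K(x,A\setminus\{x\})/a(x)$. 2. The holding times $(N_k)$ are conditionally independent given the whole sequence $(\tilde X_j)_{j\ge1}$, and, conditionally on it, $N_k$ is geometric with parameter $a(\tilde X_k)$: $\mathbb{P}(N_k = n\mid (\tilde X_j)_{j\ge1}) = (1-a(\tilde X_k))^{n-1}a(\tilde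 X_k)$ almost surely, for every $n\ge1$. 3. If a probability measure $\nu$ is invariant for $K$, then $\tilde\nu(\mathrm{d}x) := \nu(\mathrm{d}x)\,a(x)/\nu(a)$, where $\nu(a)=\int a\,\mathrm{d}\nu$, is an invariant probability measure for $\tilde K$. If moreover $K$ is reversible with respect to $\nu$, then $\tilde K$ is reversible with respect to $\tilde\nu$. 4. $K$ is $\psi$-irreducible if and only if $\tilde K$ is, and a measure is a maximal irreducibility measure of $K$ if and only if it is one of $\tilde K$. Here a $\sigma$-finite measure $\varphi$ is an irreducibility measure of a kernel $Q$ if, whenever $\varphi(A)>0$, for every $x$ there is $n\ge 1$ with $Q^n(x,A)>0$; $Q$ is $\psi$-irreducible if it has a nonzero irreducibility measure; a maximal irreducibility measure is a nonzero one that dominates all others (in the sense of absolute continuity). 5. $K$ is Harris recurrent if and only if $\tilde K$ is. Here $Q$ is Harris recurrent if it has a maximal irreducibility measure $\psi$ such that, whenever $\psi(A)>0$, for every starting point $x$ the chain with kernel $Q$ started at $x$ visits $A$ infinitely often almost surely. -/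

import Mathlib

open MeasureTheory ProbabilityTheory Filter
open scoped ENNReal

namespace JumpChain

variable {S Ω : Type*} [MeasurableSpace S] [MeasurableSpace Ω]

/-! ### Markov chains -/

/-- The transition kernel from the history `(x_0, …, x_n)` to `x_{n+1}` of a time-homogeneous
Markov chain with kernel `K`: it depends on the history only through `x_n`. -/
noncomputable def stepKernel (K : Kernel S S) (n : ℕ) : Kernel (Finset.Iic n → S) S :=
  K.comap (fun h => h ⟨n, Finset.mem_Iic.2 le_rfl⟩) (measurable_pi_apply _)

instance (K : Kernel S S) [IsMarkovKernel K] (n : ℕ) : IsMarkovKernel (stepKernel K n) := by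
  unfold stepKernel; infer_instance

/-- `X` is, under `P`, a Markov chain with transition kernel `K` (and arbitrary initial law):
the conditional law of `X_{n+1}` given `(X_0, …, X_n)` is `K(X_n, ·)`. -/
structure IsMarkovChain (X : ℕ → Ω → S) (K : Kernel S S) (P : Measure Ω) : Prop where
  measurable : ∀ n, Measurable (X n)
  hasCondDistrib : ∀ n,
    HasCondDistrib (X (n + 1)) (fun ω (i : Finset.Iic n) => X i ω) (stepKernel K n) P

/-- The law `ℙ_x` on the path space of the Markov chain with kernel `K` started at `x`. -/
noncomputable def pathLaw (K : Kernel S S) [IsMarkovKernel K] (x : S) : Measure (ℕ → S) :=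
  Kernel.traj (X := fun _ => S) (stepKernel K) 0 (fun _ => x)

/-! ### Irreducibility and Harris recurrence -/

/-- `K` is ψ-irreducible: it is `φ`-irreducible for some non-trivial σ-finite measure `φ`. -/
def IsPsiIrreducible (K : Kernel S S) : Prop :=
  ∃ φ : Measure S, SigmaFinite φ ∧ φ ≠ 0 ∧ Kernel.IsIrreducible φ K

/-- `ψ` is a maximal irreducibility measure of `K`: a non-trivial irreducibility measure which
dominates every irreducibility measure. -/
structure IsMaximalIrreducibilityMeasure (K : Kernel S S) (ψ : Measure S) : Prop where
  sigmaFinite : SigmaFinite ψ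
  ne_zero : ψ ≠ 0
  irreducible : Kernel.IsIrreducible ψ K
  maximal : ∀ φ : Measure S, SigmaFinite φ → Kernel.IsIrreducible φ K → φ ≪ ψ

/-- `K` is Harris recurrent: it is ψ-irreducible and, from every starting point, the chain almost
surely visits infinitely often every set charged by the maximal irreducibility measure. -/
def IsHarrisRecurrent (K : Kernel S S) [IsMarkovKernel K] : Prop :=
  ∃ ψ : Measure S, IsMaximalIrreducibilityMeasure K ψ ∧
    ∀ A : Set S, MeasurableSet A → 0 < ψ A →
      ∀ x : S, ∀ᵐ ω ∂(pathLaw K x), ∃ᶠ n in atTop, ω n ∈ A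

/-! ### The jump chain and its holding times -/

/-- The waiting time, from time `m` on, until the path `x` leaves the state `x m`
(with the value `0` if it never does). -/
noncomputable def waitingTime (x : ℕ → S) (m : ℕ) : ℕ :=
  sInf {j : ℕ | 1 ≤ j ∧ x (m + j) ≠ x m}

/-- The time at which the `k`-th block of repeated values begins: the sum of the first `k`
holding times. -/
noncomputable def jumpTime (x : ℕ → S) : ℕ → ℕ
  | 0 => 0
  | k + 1 => jumpTime x k + waitingTime x (jumpTime x k)

/-- The holding time of the `k`-th block. -/
noncomputable def holdingTime (x : ℕ → S) (k : ℕ) : ℕ := waitingTime x (jumpTime x k)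

/-- The jump chain: the value of the `k`-th block. -/
noncomputable def jumpChain (x : ℕ → S) (k : ℕ) : S := x (jumpTime x k)

/-! ### The jump kernel -/

/-- The probability `a(x) = K(x, S ∖ {x})` of leaving `x`. -/
noncomputable def leave (K : Kernel S S) (x : S) : ℝ≥0∞ := K x {x}ᶜ

/-- `K` is non-degenerate: `a(x) > 0` for all `x`. -/
class NonDegenerate (K : Kernel S S) : Prop where
  leave_pos : ∀ x, 0 < leave K x

theorem measurable_kernel_diff_singleton [MeasurableEq S] (K : Kernel S S) [IsMarkovKernel K]
    {A : Set S} (hA : MeasurableSet A) : Measurable fun x => K x (A \ {x}) := by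
  have hm : MeasurableSet {p : S × S | p.2 ∈ A ∧ p.2 ≠ p.1} :=
    (measurable_snd hA).inter (measurableSet_eq_fun measurable_snd measurable_fst).compl
  exact Kernel.measurable_kernel_prodMk_left (κ := K) hm

theorem measurable_leave [MeasurableEq S] (K : Kernel S S) [IsMarkovKernel K] :
    Measurable (leave K) := by
  have h := measurable_kernel_diff_singleton K (MeasurableSet.univ (α := S))
  simp only [← Set.compl_eq_univ_sdiff] at h
  exact h

/-- The kernel `K̃(x, A) = K(x, A ∖ {x}) / a(x)`. -/
noncomputable def jumpKernel [MeasurableEq S] (K : Kernel S S) [IsMarkovKernel K] :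
    Kernel S S where
  toFun x := (leave K x)⁻¹ • (K x).restrict {x}ᶜ
  measurable' := by
    refine Measure.measurable_of_measurable_coe _ fun A hA => ?_
    have h : (fun x => ((leave K x)⁻¹ • (K x).restrict {x}ᶜ) A)
        = fun x => (leave K x)⁻¹ * K x (A \ {x}) := by
      funext x
      rw [Measure.smul_apply, Measure.restrict_apply hA, smul_eq_mul, Set.sdiff_eq]
    rw [h]
    exact (measurable_leave K).inv.mul (measurable_kernel_diff_singleton K hA)

theorem jumpKernel_apply [MeasurableEq S] (K : Kernel S S) [IsMarkovKernel K] (x : S)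
    {A : Set S} (hA : MeasurableSet A) :
    jumpKernel K x A = K x (A \ {x}) / leave K x := by
  change ((leave K x)⁻¹ • (K x).restrict {x}ᶜ) A = _
  rw [Measure.smul_apply, Measure.restrict_apply hA, smul_eq_mul, Set.sdiff_eq, mul_comm,
    ENNReal.div_eq_inv_mul, mul_comm]

instance [MeasurableEq S] (K : Kernel S S) [IsMarkovKernel K] [hK : NonDegenerate K] :
    IsMarkovKernel (jumpKernel K) := by
  refine ⟨fun x => ⟨?_⟩⟩
  rw [jumpKernel_apply K x MeasurableSet.univ, ← Set.compl_eq_univ_sdiff]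
  exact ENNReal.div_self (hK.leave_pos x).ne' (measure_ne_top _ _)

/-- The probability measure `ν̃(dx) = ν(dx) a(x) / ν(a)`. -/
noncomputable def jumpMeasure (K : Kernel S S) (ν : Measure S) : Measure S :=
  (∫⁻ x, leave K x ∂ν)⁻¹ • ν.withDensity (leave K)

/-! ### Conditional independence -/

/-- The random variables `N i` are conditionally independent given the σ-algebra `m`: the
conditional probabilities of events `⋂ i ∈ s, {N i ∈ B i}` factorise. -/
def IsCondIndep {ι β : Type*} [MeasurableSpace β] (N : ι → Ω → β) (P : Measure Ω)
    (m : MeasurableSpace Ω) : Prop :=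
  ∀ (s : Finset ι) (B : ι → Set β), (∀ i, MeasurableSet (B i)) →
    P⟦⋂ i ∈ s, N i ⁻¹' B i | m⟧ =ᵐ[P] fun ω => ∏ i ∈ s, (P⟦N i ⁻¹' B i | m⟧) ω

end JumpChain

open JumpChain

/-!
The proof works with the laws `pathLaw K x` of the chains on path space and rests on two facts.

*First step* (`lintegral_pathLaw`): the chain started at `x` is `x` followed by a chain with initial
law `K x`. This equation determines the laws `pathLaw K x` (`eq_pathLaw_of_firstStep`). It holds
because being a Markov chain is a property of the law on path space, which is determined by the
kernel and the initial law (`IsMarkovChain.map_eq_map`); so the law of any Markov chain is the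
mixture of the laws `pathLaw K x` over its initial law (`IsMarkovChain.map_eq_chainLaw`).

*Regeneration* (`lintegral_regeneration`): iterating the first step, the first holding time of the
chain started at `x` is geometric with parameter `a(x)`, hence almost surely finite, and
independently of it the chain restarts at its end with initial law `jumpKernel K x`. As the jump
chain of a path is its first value followed by the jump chain of the path seen from the end of the
first block, the law of the jump chain solves the first-step equation of `jumpKernel K`, hence is
`pathLaw (jumpKernel K) x` (`map_jumpChain_pathLaw`). By the same recursion, in integrals against
functions of the whole jump chain the events `N_j ∈ B_j` may be replaced by their geometric
probabilities with parameters `a(Y_j)` (`lintegral_jumpChain_holdingTime`), which is the conditional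
independence of the holding times and their conditional law.

Irreducibility and Harris recurrence are statements about the sets of values that a path takes, and
takes infinitely often. When all blocks are finite, these are the same for a path and for its jump
chain. Invariance and reversibility follow by removing the diagonal from the flow `ν(dx) K(x, dy)`:
its diagonal part is symmetric and finite, and what remains is the flow of the jump kernel under the
jump measure, up to normalisation.
-/

namespace JumpChain

/-! ### The law of a Markov chain on path space -/

/-- The path starting at `x` and going on along `ω`. -/
def consPath {S : Type*} (x : S) (ω : ℕ → S) : ℕ → S := fun n => Nat.casesOn n x ω

@[simp] theorem consPath_zero {S : Type*} (x : S) (ω : ℕ → S) : consPath x ω 0 = x := rfl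

@[simp] theorem consPath_succ {S : Type*} (x : S) (ω : ℕ → S) (n : ℕ) :
    consPath x ω (n + 1) = ω n := rfl

section ChainLaw

variable {S Ω : Type*} [MeasurableSpace S] [MeasurableSpace Ω]

theorem ext_of_map_frestrictLe {μ ν : Measure (ℕ → S)} [IsFiniteMeasure μ]
    (h : ∀ n : ℕ, μ.map (Preorder.frestrictLe (π := fun _ => S) n) =
      ν.map (Preorder.frestrictLe (π := fun _ => S) n)) : μ = ν := by
  have hP := isProjectiveMeasureFamily_map_restrict (X := fun (i : ℕ) (ω : ℕ → S) => ω i)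
    (P := μ) (fun i => (measurable_pi_apply i).aemeasurable)
  refine IsProjectiveLimit.unique (P := fun I => μ.map fun ω => I.restrict ω) ?_ ?_
  · exact fun I => rfl
  · exact (isProjectiveLimit_nat_iff hP ν).2 fun n => (h n).symm

instance (K : Kernel S S) [IsMarkovKernel K] (x : S) : IsProbabilityMeasure (pathLaw K x) := by
  unfold pathLaw; infer_instance

theorem measurable_pathLaw (K : Kernel S S) [IsMarkovKernel K] : Measurable (pathLaw K) :=
  (Kernel.measurable _).comp (measurable_pi_lambda _ fun _ => measurable_id)

theorem measurable_lintegral_pathLaw (K : Kernel S S) [IsMarkovKernel K]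
    {F : (ℕ → S) → ℝ≥0∞} (hF : Measurable F) :
    Measurable fun x => ∫⁻ ω, F ω ∂(pathLaw K x) :=
  (Measure.measurable_lintegral hF).comp (measurable_pathLaw K)

/-- The law on path space of the chain with kernel `K` and initial law `μ`. -/
noncomputable def chainLaw (K : Kernel S S) [IsMarkovKernel K] (μ : Measure S) :
    Measure (ℕ → S) := μ.bind (pathLaw K)

theorem chainLaw_eq_trajMeasure (K : Kernel S S) [IsMarkovKernel K] (μ : Measure S) :
    chainLaw K μ = Kernel.trajMeasure (X := fun _ => S) μ (stepKernel K) := by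
  unfold chainLaw Kernel.trajMeasure
  ext s hs
  rw [Measure.bind_apply hs (measurable_pathLaw K).aemeasurable,
    Measure.bind_apply hs (Kernel.measurable _).aemeasurable,
    lintegral_map (Kernel.measurable_coe _ hs) (MeasurableEquiv.measurable _)]
  rfl

instance (K : Kernel S S) [IsMarkovKernel K] (μ : Measure S) [IsProbabilityMeasure μ] :
    IsProbabilityMeasure (chainLaw K μ) := by
  rw [chainLaw_eq_trajMeasure]; infer_instance

theorem map_zero_pathLaw (K : Kernel S S) [IsMarkovKernel K] (x : S) :
    (pathLaw K x).map (fun ω => ω 0) = Measure.dirac x := by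
  have h := Kernel.traj_map_frestrictLe_apply (κ := stepKernel K) (X := fun _ => S) 0 0
    (fun _ => x)
  rw [Kernel.partialTraj_self, Kernel.id_apply] at h
  have h2 := congrArg (Measure.map (fun h : Finset.Iic 0 → S => h ⟨0, by simp⟩)) h
  rw [Measure.map_map (by fun_prop) (by fun_prop)] at h2
  exact h2.trans (Measure.map_dirac' (by fun_prop) _)

theorem ae_zero_pathLaw (K : Kernel S S) [IsMarkovKernel K] [MeasurableSingletonClass S] (x : S) :
    ∀ᵐ ω ∂(pathLaw K x), ω 0 = x := by
  have hx : MeasurableSet {y | y = x} := measurableSet_singleton x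
  have : ∀ᵐ y ∂((pathLaw K x).map fun ω => ω 0), y = x := by
    rw [map_zero_pathLaw, ae_dirac_iff hx]
  exact ae_of_ae_map (measurable_pi_apply 0).aemeasurable this

/-- Being a Markov chain is a property of the law on path space. -/
theorem isMarkovChain_congr_law {Ω' : Type*} [MeasurableSpace Ω'] {P : Measure Ω} {Q : Measure Ω'}
    {X : ℕ → Ω → S} {Z : ℕ → Ω' → S} {K : Kernel S S} (hX : ∀ n, Measurable (X n))
    (h : P.map (fun ω n => X n ω) = Q.map (fun ω n => Z n ω)) (hZ : IsMarkovChain Z K Q) :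
    IsMarkovChain X K P := by
  refine ⟨hX, fun n => ⟨by fun_prop, ?_⟩⟩
  have hZm := hZ.measurable
  have e := (hZ.hasCondDistrib n).map_eq
  have h1 := congrArg
    (Measure.map fun x : ℕ → S => ((fun i : Finset.Iic n => x i), x (n + 1))) h
  have h2 := congrArg (Measure.map fun x : ℕ → S => (fun i : Finset.Iic n => x i)) h
  rw [Measure.map_map (by fun_prop) (by fun_prop), Measure.map_map (by fun_prop) (by fun_prop)]
    at h1 h2
  simp only [Function.comp_def] at h1 h2
  rw [h1, h2, e]

/-- The coordinate process is a Markov chain under the law `chainLaw K μ`. -/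
theorem isMarkovChain_coord (K : Kernel S S) [IsMarkovKernel K] (μ : Measure S)
    [IsProbabilityMeasure μ] :
    IsMarkovChain (fun n (ω : ℕ → S) => ω n) K (chainLaw K μ) := by
  refine ⟨fun n => measurable_pi_apply n, fun n => ⟨by fun_prop, ?_⟩⟩
  rw [chainLaw_eq_trajMeasure]
  exact (Kernel.map_frestrictLe_trajMeasure_compProd_eq_map_trajMeasure
    (X := fun _ => S) (κ := stepKernel K) (μ₀ := μ) (a := n)).symm

/-- The law of a Markov chain is determined by its kernel and its initial law. -/
theorem IsMarkovChain.map_eq_map {Ω' : Type*} [MeasurableSpace Ω'] {P : Measure Ω}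
    [IsFiniteMeasure P] {Q : Measure Ω'} {X : ℕ → Ω → S} {Z : ℕ → Ω' → S}
    {K : Kernel S S} (hX : IsMarkovChain X K P) (hZ : IsMarkovChain Z K Q)
    (h0 : P.map (X 0) = Q.map (Z 0)) :
    P.map (fun ω n => X n ω) = Q.map (fun ω n => Z n ω) := by
  have hXm := hX.measurable
  have hZm := hZ.measurable
  have key : ∀ n : ℕ, P.map (fun ω (i : Finset.Iic n) => X i ω) =
      Q.map (fun ω (i : Finset.Iic n) => Z i ω) := by
    intro n
    induction n with
    | zero =>
      have h := congrArg (Measure.map fun (x : S) (_ : Finset.Iic 0) => x) h0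
      rw [Measure.map_map (by fun_prop) (by fun_prop),
        Measure.map_map (by fun_prop) (by fun_prop)] at h
      have e : ∀ i : Finset.Iic 0, (i : ℕ) = 0 := fun i => Nat.le_zero.1 (Finset.mem_Iic.1 i.2)
      simp only [e]
      exact h
    | succ n ih =>
      have e := (hX.hasCondDistrib n).map_eq
      rw [ih, ← (hZ.hasCondDistrib n).map_eq] at e
      -- the history up to time `n + 1` is the history up to `n` followed by the value at `n + 1`
      let g : (Finset.Iic n → S) × S → (Finset.Iic (n + 1) → S) := fun p i =>
        if h : (i : ℕ) ≤ n then p.1 ⟨i, Finset.mem_Iic.2 h⟩ else p.2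
      have hg : Measurable g := by
        refine measurable_pi_lambda _ fun i => ?_
        by_cases h : (i : ℕ) ≤ n
        · simp only [g, h, dite_true]; fun_prop
        · simp only [g, h, dite_false]; fun_prop
      have h := congrArg (Measure.map g) e
      rw [Measure.map_map hg (by fun_prop), Measure.map_map hg (by fun_prop)] at h
      have aux : ∀ x : ℕ → S, g ((fun i : Finset.Iic n => x i), x (n + 1)) =
          fun i : Finset.Iic (n + 1) => x i := by
        intro x
        funext i
        by_cases h : (i : ℕ) ≤ n
        · simp [g, h]
        · have : (i : ℕ) = n + 1 := le_antisymm (Finset.mem_Iic.1 i.2) (by omega)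
          simp [g, this]
      have hXe : (g ∘ fun ω => ((fun i : Finset.Iic n => X i ω), X (n + 1) ω)) =
          fun ω (i : Finset.Iic (n + 1)) => X i ω := funext fun ω => aux fun n => X n ω
      have hZe : (g ∘ fun ω => ((fun i : Finset.Iic n => Z i ω), Z (n + 1) ω)) =
          fun ω (i : Finset.Iic (n + 1)) => Z i ω := funext fun ω => aux fun n => Z n ω
      rwa [hXe, hZe] at h
  refine ext_of_map_frestrictLe fun n => ?_
  rw [Measure.map_map (by fun_prop) (by fun_prop), Measure.map_map (by fun_prop) (by fun_prop)]
  exact key n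

theorem map_zero_chainLaw (K : Kernel S S) [IsMarkovKernel K] (μ : Measure S) :
    (chainLaw K μ).map (fun ω => ω 0) = μ := by
  ext A hA
  have hm : MeasurableSet ((fun ω : ℕ → S => ω 0) ⁻¹' A) := measurable_pi_apply 0 hA
  rw [Measure.map_apply (by fun_prop) hA, chainLaw,
    Measure.bind_apply hm (measurable_pathLaw K).aemeasurable]
  have : ∀ x, pathLaw K x ((fun ω : ℕ → S => ω 0) ⁻¹' A) = A.indicator 1 x := fun x => by
    rw [← Measure.map_apply (by fun_prop) hA, map_zero_pathLaw, Measure.dirac_apply' _ hA]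
  simp_rw [this]
  exact lintegral_indicator_one hA

theorem IsMarkovChain.map_eq_chainLaw {P : Measure Ω} [IsProbabilityMeasure P] {X : ℕ → Ω → S}
    {K : Kernel S S} [IsMarkovKernel K] (hX : IsMarkovChain X K P) :
    P.map (fun ω n => X n ω) = chainLaw K (P.map (X 0)) := by
  have := Measure.isProbabilityMeasure_map (μ := P) (hX.measurable 0).aemeasurable
  rw [hX.map_eq_map (isMarkovChain_coord K (P.map (X 0))) (map_zero_chainLaw _ _).symm]
  exact Measure.map_id

theorem isMarkovChain_of_map_eq_chainLaw {P : Measure Ω} {X : ℕ → Ω → S} {K : Kernel S S}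
    [IsMarkovKernel K] {μ : Measure S} [IsProbabilityMeasure μ] (hXm : ∀ n, Measurable (X n))
    (h : P.map (fun ω n => X n ω) = chainLaw K μ) : IsMarkovChain X K P :=
  isMarkovChain_congr_law hXm (h.trans Measure.map_id.symm) (isMarkovChain_coord K μ)

theorem pathLaw_eq_chainLaw (K : Kernel S S) [IsMarkovKernel K] (x : S) :
    pathLaw K x = chainLaw K (Measure.dirac x) := by
  rw [chainLaw, Measure.dirac_bind (measurable_pathLaw K)]

theorem lintegral_chainLaw (K : Kernel S S) [IsMarkovKernel K] (μ : Measure S)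
    {F : (ℕ → S) → ℝ≥0∞} (hF : Measurable F) :
    ∫⁻ ω, F ω ∂(chainLaw K μ) = ∫⁻ x, ∫⁻ ω, F ω ∂(pathLaw K x) ∂μ :=
  Measure.lintegral_bind (measurable_pathLaw K).aemeasurable hF.aemeasurable

theorem measurable_consPath : Measurable fun p : S × (ℕ → S) => consPath p.1 p.2 := by
  refine measurable_pi_lambda _ fun n => ?_
  cases n with
  | zero => exact measurable_fst
  | succ n => exact (measurable_pi_apply n).comp measurable_snd

theorem measurable_consPath_right (x : S) : Measurable (consPath x) :=
  measurable_consPath.comp measurable_prodMk_left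

/-- The time-shifted coordinate process of a chain is again a chain with the same kernel. -/
theorem isMarkovChain_shift {X : ℕ → Ω → S} {K : Kernel S S} [IsMarkovKernel K] {P : Measure Ω}
    [IsFiniteMeasure P] (hX : IsMarkovChain X K P) : IsMarkovChain (fun n => X (n + 1)) K P := by
  refine ⟨fun n => hX.measurable _, fun n => ?_⟩
  let f : (Finset.Iic (n + 1) → S) → (Finset.Iic n → S) := fun h i =>
    h ⟨i + 1, Finset.mem_Iic.2 (Nat.succ_le_succ (Finset.mem_Iic.1 i.2))⟩
  exact HasCondDistrib.comp_right (f := f) (hf := by fun_prop)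
    (κ := stepKernel K n) (hX.hasCondDistrib (n + 1))

/-- First-step decomposition: the chain started at `x` is `x` followed by a chain whose initial law
is `K x`. -/
theorem lintegral_pathLaw (K : Kernel S S) [IsMarkovKernel K] [MeasurableSingletonClass S] (x : S)
    {F : (ℕ → S) → ℝ≥0∞} (hF : Measurable F) :
    ∫⁻ ω, F ω ∂(pathLaw K x) = ∫⁻ y, ∫⁻ ω, F (consPath x ω) ∂(pathLaw K y) ∂(K x) := by
  have hc : IsMarkovChain (fun n (ω : ℕ → S) => ω n) K (pathLaw K x) := by
    rw [pathLaw_eq_chainLaw]; exact isMarkovChain_coord K _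
  have h1 : (pathLaw K x).map (fun ω => ω 1) = K x := by
    have h := Kernel.map_traj_succ_self (κ := stepKernel K) (X := fun _ => S) (a := 0)
    have h' := DFunLike.congr_fun h (fun _ => x)
    rw [Kernel.map_apply _ (by fun_prop)] at h'
    exact h'
  have hs := (isMarkovChain_shift hc).map_eq_chainLaw
  rw [show (0 : ℕ) + 1 = 1 from rfl, h1] at hs
  have hFx : Measurable fun ω => F (consPath x ω) := hF.comp (measurable_consPath_right x)
  rw [← lintegral_chainLaw K (K x) hFx, ← hs, lintegral_map hFx (by fun_prop)]
  refine lintegral_congr_ae ?_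
  filter_upwards [ae_zero_pathLaw K x] with ω hω
  congr 1
  funext n
  cases n with
  | zero => exact hω
  | succ n => rfl

/-- The laws of the chains with kernel `K` are the only solution of the first-step equation. -/
theorem eq_pathLaw_of_firstStep (K : Kernel S S) [IsMarkovKernel K] [MeasurableSingletonClass S]
    {η : S → Measure (ℕ → S)} [∀ x, IsProbabilityMeasure (η x)]
    (h : ∀ x, ∀ F : (ℕ → S) → ℝ≥0∞, Measurable F →
      ∫⁻ ω, F ω ∂(η x) = ∫⁻ y, ∫⁻ ω, F (consPath x ω) ∂(η y) ∂(K x)) (x : S) :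
    η x = pathLaw K x := by
  -- the two laws agree on functions of the first `n` coordinates, by induction on `n`
  have key : ∀ n (F : (ℕ → S) → ℝ≥0∞), Measurable F → DependsOn F (Set.Iio n) → ∀ x,
      ∫⁻ ω, F ω ∂(η x) = ∫⁻ ω, F ω ∂(pathLaw K x) := by
    intro n
    induction n with
    | zero =>
      intro F hF hd x
      have : ∀ ω, F ω = F (fun _ => x) := fun ω => hd fun i hi => absurd hi (by simp)
      simp_rw [this]
      simp
    | succ n ih =>
      intro F hF hd x
      rw [h x F hF, lintegral_pathLaw K x hF]
      refine lintegral_congr fun y => ih _ (hF.comp (measurable_consPath_right x)) ?_ y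
      intro ω ω' hω
      refine hd fun i hi => ?_
      cases i with
      | zero => rfl
      | succ i => exact hω i (by simpa using hi)
  refine ext_of_map_frestrictLe fun n => ?_
  ext A hA
  have hm : Measurable (Preorder.frestrictLe (π := fun _ => S) n) :=
    Preorder.measurable_frestrictLe n
  rw [Measure.map_apply hm hA, Measure.map_apply hm hA, ← lintegral_indicator_one (hm hA),
    ← lintegral_indicator_one (hm hA)]
  refine key (n + 1) _ (measurable_one.indicator (hm hA)) ?_ x
  intro ω ω' hω
  have : Preorder.frestrictLe (π := fun _ => S) n ω = Preorder.frestrictLe n ω' := by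
    funext i
    exact hω i (Nat.lt_succ_of_le (Finset.mem_Iic.1 i.2))
  exact Set.indicator_eq_indicator (by rw [Set.mem_preimage, Set.mem_preimage, this]) rfl

end ChainLaw

/-! ### Blocks of a path -/

section Path

variable {S : Type*}

/-- The path seen from time `m` on. -/
def shiftPath (m : ℕ) (x : ℕ → S) : ℕ → S := fun n => x (m + n)

/-- The path never gets stuck: it leaves each of its blocks. A `waitingTime` of `0` encodes that the
path stays for ever, see `waitingTime_eq_zero_iff`. -/
def AllBlocksFinite (x : ℕ → S) : Prop := ∀ k, waitingTime x (jumpTime x k) ≠ 0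

theorem waitingTime_eq_zero_iff (x : ℕ → S) (m : ℕ) :
    waitingTime x m = 0 ↔ ∀ j, x (m + j) = x m := by
  unfold waitingTime
  rw [Nat.sInf_eq_zero]
  constructor
  · rintro (h | h) j
    · exact absurd h.1 (by norm_num)
    · by_contra hj
      refine (h ▸ (⟨Nat.one_le_iff_ne_zero.2 ?_, hj⟩ : j ∈ {j | 1 ≤ j ∧ x (m + j) ≠ x m}) :
        j ∈ (∅ : Set ℕ))
      rintro rfl
      exact hj rfl
  · intro h
    right
    ext j
    simp [h j]

theorem waitingTime_eq_iff (x : ℕ → S) (m n : ℕ) :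
    waitingTime x m = n + 1 ↔ (∀ j ≤ n, x (m + j) = x m) ∧ x (m + (n + 1)) ≠ x m := by
  constructor
  · intro h
    have hne : {j : ℕ | 1 ≤ j ∧ x (m + j) ≠ x m}.Nonempty := by
      refine Nat.nonempty_of_pos_sInf ?_
      change 0 < waitingTime x m
      omega
    have hmem := Nat.sInf_mem hne
    change 1 ≤ waitingTime x m ∧ x (m + waitingTime x m) ≠ x m at hmem
    rw [h] at hmem
    refine ⟨fun j hj => ?_, hmem.2⟩
    by_contra hc
    have hj1 : 1 ≤ j := Nat.one_le_iff_ne_zero.2 fun h0 => hc (by rw [h0]; rfl)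
    have : waitingTime x m ≤ j := Nat.sInf_le ⟨hj1, hc⟩
    omega
  · rintro ⟨h1, h2⟩
    refine le_antisymm (Nat.sInf_le ⟨by omega, h2⟩) (le_csInf ⟨_, by omega, h2⟩ ?_)
    rintro j ⟨-, hj⟩
    by_contra hc
    exact hj (h1 j (by omega))

theorem exists_ne_of_waitingTime_ne_zero {x : ℕ → S} {m : ℕ} (h : waitingTime x m ≠ 0) :
    ∃ j ≥ 1, x (m + j) ≠ x m := by
  obtain ⟨n, hn⟩ := Nat.exists_eq_succ_of_ne_zero h
  exact ⟨n + 1, by omega, ((waitingTime_eq_iff x m n).1 hn).2⟩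

theorem waitingTime_shiftPath (m i : ℕ) (x : ℕ → S) :
    waitingTime (shiftPath m x) i = waitingTime x (m + i) := by
  simp only [waitingTime, shiftPath, add_assoc]

theorem jumpTime_succ' (x : ℕ → S) (k : ℕ) :
    jumpTime x (k + 1) =
      waitingTime x 0 + jumpTime (shiftPath (waitingTime x 0) x) k := by
  induction k with
  | zero => simp [jumpTime]
  | succ k ih =>
    rw [jumpTime, ih, jumpTime, waitingTime_shiftPath, add_assoc]

theorem holdingTime_succ (x : ℕ → S) (k : ℕ) :
    holdingTime x (k + 1) = holdingTime (shiftPath (waitingTime x 0) x) k := by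
  rw [holdingTime, jumpTime_succ', holdingTime, waitingTime_shiftPath]

theorem jumpChain_succ (x : ℕ → S) (k : ℕ) :
    jumpChain x (k + 1) = jumpChain (shiftPath (waitingTime x 0) x) k := by
  rw [jumpChain, jumpTime_succ', jumpChain, shiftPath]

/-- The jump chain of a path starts where the path starts and then follows the jump chain of the
path seen from the end of the first block. -/
theorem jumpChain_eq_consPath (x : ℕ → S) :
    jumpChain x = consPath (x 0) (jumpChain (shiftPath (waitingTime x 0) x)) := by
  funext k
  cases k with
  | zero => rfl
  | succ k => exact jumpChain_succ x k

theorem waitingTime_consPath_of_ne {x : S} {ω : ℕ → S} (h : ω 0 ≠ x) :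
    waitingTime (consPath x ω) 0 = 1 := by
  rw [waitingTime_eq_iff]
  refine ⟨fun j hj => ?_, by simpa using h⟩
  obtain rfl : j = 0 := by omega
  rfl

theorem waitingTime_consPath_of_eq {x : S} {ω : ℕ → S} (h : ω 0 = x) (n : ℕ) :
    waitingTime (consPath x ω) 0 = n + 2 ↔ waitingTime ω 0 = n + 1 := by
  rw [waitingTime_eq_iff, waitingTime_eq_iff]
  simp only [zero_add, consPath_succ, consPath_zero, h]
  refine and_congr_left fun _ => ⟨fun H j hj => H (j + 1) (by omega), fun H j hj => ?_⟩
  cases j with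
  | zero => rfl
  | succ j => exact H j (by omega)

theorem waitingTime_consPath_of_eq_ne_one {x : S} {ω : ℕ → S} (h : ω 0 = x) :
    waitingTime (consPath x ω) 0 ≠ 1 := by
  intro hc
  have := ((waitingTime_eq_iff (consPath x ω) 0 0).1 hc).2
  exact this (by simpa using h)

theorem AllBlocksFinite.strictMono {x : ℕ → S} (h : AllBlocksFinite x) :
    StrictMono (jumpTime x) :=
  strictMono_nat_of_lt_succ fun k => by
    have := h k
    rw [jumpTime]
    omega

/-- Every time belongs to one of the blocks, on which the path is constant. -/
theorem AllBlocksFinite.exists_block {x : ℕ → S} (h : AllBlocksFinite x) (n : ℕ) :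
    ∃ k, jumpTime x k ≤ n ∧ n < jumpTime x (k + 1) ∧ x n = jumpChain x k := by
  have hex : ∃ k, n < jumpTime x (k + 1) := ⟨n, (h.strictMono.id_le (n + 1))⟩
  classical
  have h1 : n < jumpTime x (Nat.find hex + 1) := Nat.find_spec hex
  have h2 : jumpTime x (Nat.find hex) ≤ n := by
    rcases hk : Nat.find hex with _ | k
    · exact Nat.zero_le _
    · exact not_lt.1 (Nat.find_min hex (m := k) (by omega))
  refine ⟨Nat.find hex, h2, h1, ?_⟩
  obtain ⟨w, hw⟩ := Nat.exists_eq_succ_of_ne_zero (h (Nat.find hex))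
  have := ((waitingTime_eq_iff x (jumpTime x (Nat.find hex)) w).1 hw).1
    (n - jumpTime x (Nat.find hex)) (by rw [jumpTime] at h1; omega)
  rwa [Nat.add_sub_cancel' h2] at this

theorem AllBlocksFinite.exists_mem_iff {x : ℕ → S} (h : AllBlocksFinite x) (A : Set S) :
    (∃ n, x n ∈ A) ↔ ∃ k, jumpChain x k ∈ A := by
  constructor
  · rintro ⟨n, hn⟩
    obtain ⟨k, -, -, hk⟩ := h.exists_block n
    exact ⟨k, hk ▸ hn⟩
  · rintro ⟨k, hk⟩
    exact ⟨_, hk⟩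

/-- A path visits a set infinitely often if and only if its jump chain does. -/
theorem AllBlocksFinite.frequently_mem_iff {x : ℕ → S} (h : AllBlocksFinite x) (A : Set S) :
    (∃ᶠ n in atTop, x n ∈ A) ↔ ∃ᶠ k in atTop, jumpChain x k ∈ A := by
  rw [frequently_atTop, frequently_atTop]
  constructor
  · intro H a
    obtain ⟨n, hn, hnA⟩ := H (jumpTime x a)
    obtain ⟨k, -, hk, hx⟩ := h.exists_block n
    exact ⟨k, Nat.lt_succ_iff.1 (h.strictMono.lt_iff_lt.1 (hn.trans_lt hk)), hx ▸ hnA⟩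
  · intro H a
    obtain ⟨k, hk, hkA⟩ := H a
    exact ⟨jumpTime x k, hk.trans (h.strictMono.id_le k), hkA⟩

end Path

section MeasurablePath

variable {S : Type*} [MeasurableSpace S]

theorem measurable_shiftPath (m : ℕ) : Measurable (shiftPath (S := S) m) :=
  measurable_pi_lambda _ fun _ => measurable_pi_apply _

variable [MeasurableEq S]

theorem measurable_waitingTime (m : ℕ) : Measurable fun x : ℕ → S => waitingTime x m := by
  have heq : ∀ i j : ℕ, MeasurableSet {x : ℕ → S | x i = x j} := fun i j =>
    measurableSet_eq_fun (measurable_pi_apply i) (measurable_pi_apply j)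
  refine measurable_to_countable' fun n => ?_
  cases n with
  | zero =>
    have : (fun x : ℕ → S => waitingTime x m) ⁻¹' {0} = ⋂ j, {x | x (m + j) = x m} := by
      ext x
      simp [waitingTime_eq_zero_iff]
    rw [this]
    exact MeasurableSet.iInter fun j => heq _ _
  | succ n =>
    have : (fun x : ℕ → S => waitingTime x m) ⁻¹' {n + 1} =
        (⋂ j ≤ n, {x | x (m + j) = x m}) ∩ {x | x (m + (n + 1)) = x m}ᶜ := by
      ext x
      simp [waitingTime_eq_iff]
    rw [this]
    exact (MeasurableSet.iInter fun j => MeasurableSet.iInter fun _ => heq _ _).inter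
      (heq _ _).compl

theorem measurable_jumpTime (k : ℕ) : Measurable fun x : ℕ → S => jumpTime x k := by
  induction k with
  | zero => exact measurable_const
  | succ k ih =>
    have h : Measurable fun p : ℕ × (ℕ → S) => waitingTime p.2 p.1 :=
      measurable_from_prod_countable_right fun m => measurable_waitingTime m
    exact ih.add (h.comp (ih.prodMk measurable_id))

theorem measurable_holdingTime (k : ℕ) : Measurable fun x : ℕ → S => holdingTime x k := by
  have h : Measurable fun p : ℕ × (ℕ → S) => waitingTime p.2 p.1 :=
    measurable_from_prod_countable_right fun m => measurable_waitingTime m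
  exact h.comp ((measurable_jumpTime k).prodMk measurable_id)

theorem measurable_jumpChain : Measurable (jumpChain (S := S)) := by
  refine measurable_pi_lambda _ fun k => ?_
  have h : Measurable fun p : ℕ × (ℕ → S) => p.2 p.1 :=
    measurable_from_prod_countable_right fun m => measurable_pi_apply m
  exact h.comp ((measurable_jumpTime k).prodMk measurable_id)

end MeasurablePath

/-! ### The geometric distribution of a holding time -/

/-- The mass that the geometric distribution on `{1, 2, …}` with parameter `p` gives to `B`. -/
noncomputable def geometricMass (p : ℝ≥0∞) (B : Set ℕ) : ℝ≥0∞ :=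
  ∑' n : ℕ, B.indicator 1 (n + 1) * ((1 - p) ^ n * p)

theorem measurable_geometricMass (B : Set ℕ) : Measurable fun p => geometricMass p B := by
  unfold geometricMass
  fun_prop

theorem geometricMass_singleton (p : ℝ≥0∞) (n : ℕ) :
    geometricMass p {n + 1} = (1 - p) ^ n * p := by
  unfold geometricMass
  rw [tsum_eq_single n fun m hm => by simp [hm]]
  simp

theorem geometricMass_univ {p : ℝ≥0∞} (h0 : p ≠ 0) (h1 : p ≤ 1) :
    geometricMass p Set.univ = 1 := by
  unfold geometricMass
  simp only [Set.indicator_univ, Pi.one_apply, one_mul]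
  rw [ENNReal.tsum_mul_right, ENNReal.tsum_geometric, ENNReal.sub_sub_cancel ENNReal.one_ne_top h1]
  exact ENNReal.inv_mul_cancel h0 (ne_top_of_le_ne_top ENNReal.one_ne_top h1)

theorem geometricMass_le_one {p : ℝ≥0∞} (h0 : p ≠ 0) (h1 : p ≤ 1) (B : Set ℕ) :
    geometricMass p B ≤ 1 := by
  rw [← geometricMass_univ h0 h1]
  refine ENNReal.tsum_le_tsum fun n => ?_
  gcongr
  exact Set.subset_univ B

/-! ### Regeneration at the end of a block -/

theorem leave_le_one {S : Type*} [MeasurableSpace S] (K : Kernel S S) [IsMarkovKernel K] (x : S) :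
    leave K x ≤ 1 := prob_le_one

section Regeneration

variable {S : Type*} [MeasurableSpace S] [MeasurableEq S] (K : Kernel S S) [IsMarkovKernel K]

theorem measure_singleton_eq (x : S) : K x {x} = 1 - leave K x := by
  rw [leave, prob_compl_eq_one_sub (measurableSet_singleton x),
    ENNReal.sub_sub_cancel ENNReal.one_ne_top prob_le_one]

/-- With probability `(1 - a(x)) ^ n` the chain started at `x` stays there for `n` further steps;
it then restarts from a point distributed according to `K x`, on leaving `x`. -/
theorem lintegral_waitingTime_eq (n : ℕ) {F : (ℕ → S) → ℝ≥0∞} (hF : Measurable F) (x : S) :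
    ∫⁻ ω, {ω | waitingTime ω 0 = n + 1}.indicator (fun ω => F (shiftPath (n + 1) ω)) ω
        ∂(pathLaw K x) =
      (1 - leave K x) ^ n * ∫⁻ y in {x}ᶜ, ∫⁻ ω, F ω ∂(pathLaw K y) ∂(K x) := by
  have hset : ∀ n : ℕ, MeasurableSet {ω : ℕ → S | waitingTime ω 0 = n} := fun n =>
    measurable_waitingTime 0 (measurableSet_singleton n)
  have hmeas : ∀ n : ℕ, Measurable ({ω : ℕ → S | waitingTime ω 0 = n + 1}.indicator
      fun ω => F (shiftPath (n + 1) ω)) := fun n =>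
    (hF.comp (measurable_shiftPath _)).indicator (hset _)
  have hx : MeasurableSet ({x} : Set S) := measurableSet_singleton x
  induction n with
  | zero =>
    rw [lintegral_pathLaw K x (hmeas 0), pow_zero, one_mul, ← lintegral_indicator hx.compl]
    refine lintegral_congr fun y => ?_
    by_cases hy : y = x
    · rw [Set.indicator_of_notMem (by simpa using hy)]
      rw [← lintegral_zero (μ := pathLaw K y)]
      refine lintegral_congr_ae ?_
      filter_upwards [ae_zero_pathLaw K y] with ω hω
      refine Set.indicator_of_notMem ?_ _
      exact waitingTime_consPath_of_eq_ne_one (hω.trans hy)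
    · rw [Set.indicator_of_mem (by simpa using hy)]
      refine lintegral_congr_ae ?_
      filter_upwards [ae_zero_pathLaw K y] with ω hω
      have hw : waitingTime (consPath x ω) 0 = 0 + 1 :=
        waitingTime_consPath_of_ne (by rw [hω]; exact hy)
      rw [Set.indicator_of_mem (s := {ω : ℕ → S | waitingTime ω 0 = 0 + 1}) hw]
      congr 1
      funext i
      rw [shiftPath, show 0 + 1 + i = i + 1 by omega, consPath_succ]
  | succ n ih =>
    rw [lintegral_pathLaw K x (hmeas (n + 1))]
    -- only the transition from `x` to itself contributes, and it does so by the previous case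
    have hstep : ∀ y, ∫⁻ ω, {ω : ℕ → S | waitingTime ω 0 = n + 1 + 1}.indicator
        (fun ω => F (shiftPath (n + 1 + 1) ω)) (consPath x ω) ∂(pathLaw K y) =
        ({x} : Set S).indicator (fun _ => (1 - leave K x) ^ n *
          ∫⁻ y in {x}ᶜ, ∫⁻ ω, F ω ∂(pathLaw K y) ∂(K x)) y := by
      intro y
      by_cases hy : y = x
      · rw [Set.indicator_of_mem (by simpa using hy), ← ih, hy]
        refine lintegral_congr_ae ?_
        filter_upwards [ae_zero_pathLaw K x] with ω hω
        refine Set.indicator_eq_indicator (waitingTime_consPath_of_eq hω n) ?_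
        congr 1
        funext i
        rw [shiftPath, shiftPath, show n + 1 + 1 + i = n + 1 + i + 1 by omega, consPath_succ]
      · rw [Set.indicator_of_notMem (by simpa using hy), ← lintegral_zero (μ := pathLaw K y)]
        refine lintegral_congr_ae ?_
        filter_upwards [ae_zero_pathLaw K y] with ω hω
        refine Set.indicator_of_notMem ?_ _
        have := waitingTime_consPath_of_ne (x := x) (ω := ω) (by rw [hω]; exact hy)
        rw [Set.mem_ofPred_eq, this]
        omega
    simp_rw [hstep]
    rw [lintegral_indicator_const hx, measure_singleton_eq, pow_succ]
    ring

variable [hK : NonDegenerate K]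

theorem ae_waitingTime_ne_zero (x : S) : ∀ᵐ ω ∂(pathLaw K x), waitingTime ω 0 ≠ 0 := by
  have hset : ∀ n : ℕ, MeasurableSet {ω : ℕ → S | waitingTime ω 0 = n} := fun n =>
    measurable_waitingTime 0 (measurableSet_singleton n)
  have hn : ∀ n : ℕ, pathLaw K x {ω | waitingTime ω 0 = n + 1} =
      Set.univ.indicator 1 (n + 1) * ((1 - leave K x) ^ n * leave K x) := by
    intro n
    have h := lintegral_waitingTime_eq K n (F := fun _ => 1) measurable_const x
    simp only [lintegral_one, measure_univ] at h
    rw [Set.indicator_univ, Pi.one_apply, one_mul]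
    have e : ∫⁻ ω, {ω : ℕ → S | waitingTime ω 0 = n + 1}.indicator (fun _ => (1 : ℝ≥0∞)) ω
        ∂(pathLaw K x) = pathLaw K x {ω | waitingTime ω 0 = n + 1} :=
      lintegral_indicator_one (hset _)
    rw [← e, h, Measure.restrict_apply_univ]
    rfl
  have hU : {ω : ℕ → S | waitingTime ω 0 ≠ 0} = ⋃ n : ℕ, {ω | waitingTime ω 0 = n + 1} := by
    ext ω
    simp [Nat.exists_eq_add_one, Nat.pos_iff_ne_zero]
  have h1 : pathLaw K x {ω | waitingTime ω 0 ≠ 0} = 1 := by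
    rw [hU, measure_iUnion _ fun n => hset _]
    · simp_rw [hn]
      exact geometricMass_univ (hK.leave_pos x).ne' (leave_le_one K x)
    · intro i j hij
      refine Set.disjoint_left.2 fun ω hi hj => hij ?_
      simp only [Set.mem_ofPred_eq] at hi hj
      omega
  exact (prob_compl_eq_zero_iff (hset 0).compl).2 h1

/-- Regeneration: the first holding time of the chain started at `x` is geometric with parameter
`a(x)`, and independently of it the chain restarts afterwards with initial law
`jumpKernel K x`. -/
theorem lintegral_regeneration (B : Set ℕ) {F : (ℕ → S) → ℝ≥0∞} (hF : Measurable F) (x : S) :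
    ∫⁻ ω, B.indicator 1 (waitingTime ω 0) * F (shiftPath (waitingTime ω 0) ω) ∂(pathLaw K x) =
      geometricMass (leave K x) B *
        ∫⁻ y, ∫⁻ ω, F ω ∂(pathLaw K y) ∂(jumpKernel K x) := by
  have hset : ∀ n : ℕ, MeasurableSet {ω : ℕ → S | waitingTime ω 0 = n} := fun n =>
    measurable_waitingTime 0 (measurableSet_singleton n)
  have hmeas : ∀ n : ℕ, Measurable ({ω : ℕ → S | waitingTime ω 0 = n + 1}.indicator
      fun ω => F (shiftPath (n + 1) ω)) := fun n =>
    (hF.comp (measurable_shiftPath _)).indicator (hset _)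
  have hsum : ∫⁻ ω, B.indicator 1 (waitingTime ω 0) * F (shiftPath (waitingTime ω 0) ω)
      ∂(pathLaw K x) = ∫⁻ ω, ∑' n : ℕ, B.indicator 1 (n + 1) *
        {ω | waitingTime ω 0 = n + 1}.indicator (fun ω => F (shiftPath (n + 1) ω)) ω
      ∂(pathLaw K x) := by
    refine lintegral_congr_ae ?_
    filter_upwards [ae_waitingTime_ne_zero K x] with ω hω
    obtain ⟨n, hn⟩ := Nat.exists_eq_succ_of_ne_zero hω
    rw [tsum_eq_single n fun m hm => ?_]
    · rw [Set.indicator_of_mem (s := {ω : ℕ → S | waitingTime ω 0 = n + 1}) hn, hn]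
    · rw [Set.indicator_of_notMem (s := {ω : ℕ → S | waitingTime ω 0 = m + 1}), mul_zero]
      simp only [Set.mem_ofPred_eq]
      omega
  rw [hsum, lintegral_tsum fun n => ((hmeas n).const_mul _).aemeasurable, geometricMass,
    ← ENNReal.tsum_mul_right]
  refine tsum_congr fun n => ?_
  have hj : ∫⁻ y, ∫⁻ ω, F ω ∂(pathLaw K y) ∂(jumpKernel K x) =
      (leave K x)⁻¹ * ∫⁻ y in {x}ᶜ, ∫⁻ ω, F ω ∂(pathLaw K y) ∂(K x) :=
    lintegral_smul_measure _ _
  rw [lintegral_const_mul _ (hmeas n), lintegral_waitingTime_eq K n hF x, hj]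
  have hc : leave K x * (leave K x)⁻¹ = 1 :=
    ENNReal.mul_inv_cancel (hK.leave_pos x).ne' (measure_ne_top _ _)
  calc _ = B.indicator 1 (n + 1) * ((1 - leave K x) ^ n *
        ((leave K x * (leave K x)⁻¹) * ∫⁻ y in {x}ᶜ, ∫⁻ ω, F ω ∂(pathLaw K y) ∂(K x))) := by
        rw [hc, one_mul]
    _ = _ := by ring

theorem lintegral_regeneration_univ {F : (ℕ → S) → ℝ≥0∞} (hF : Measurable F) (x : S) :
    ∫⁻ ω, F (shiftPath (waitingTime ω 0) ω) ∂(pathLaw K x) =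
      ∫⁻ y, ∫⁻ ω, F ω ∂(pathLaw K y) ∂(jumpKernel K x) := by
  have h := lintegral_regeneration K Set.univ hF x
  rw [geometricMass_univ (hK.leave_pos x).ne' (leave_le_one K x), one_mul] at h
  simpa using h

theorem ae_allBlocksFinite (x : S) : ∀ᵐ ω ∂(pathLaw K x), AllBlocksFinite ω := by
  have hset : ∀ k : ℕ, MeasurableSet {ω : ℕ → S | holdingTime ω k = 0} := fun k =>
    measurable_holdingTime k (measurableSet_singleton 0)
  refine ae_all_iff.2 fun k => ?_
  induction k generalizing x with
  | zero => exact ae_waitingTime_ne_zero K x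
  | succ k ih =>
    have hF : Measurable ({ω : ℕ → S | holdingTime ω k = 0}.indicator (1 : (ℕ → S) → ℝ≥0∞)) :=
      measurable_one.indicator (hset k)
    have h := lintegral_regeneration_univ K hF x
    have hy : ∀ y, ∫⁻ ω, {ω : ℕ → S | holdingTime ω k = 0}.indicator 1 ω ∂(pathLaw K y) = 0 := by
      intro y
      rw [lintegral_indicator_one (hset k)]
      have := ae_iff.1 (ih y)
      simpa [holdingTime] using this
    have hs : ∀ ω : ℕ → S, {ω : ℕ → S | holdingTime ω k = 0}.indicator (1 : (ℕ → S) → ℝ≥0∞)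
        (shiftPath (waitingTime ω 0) ω) = {ω | holdingTime ω (k + 1) = 0}.indicator 1 ω := by
      intro ω
      refine Set.indicator_eq_indicator ?_ rfl
      rw [Set.mem_ofPred_eq, Set.mem_ofPred_eq, holdingTime_succ]
    simp only [hy, hs] at h
    rw [lintegral_zero, lintegral_indicator_one (hset (k + 1))] at h
    rw [ae_iff]
    simpa [holdingTime] using h

/-- The jump chain of the chain with kernel `K` started at `x` is the chain with kernel
`jumpKernel K` started at `x`. -/
theorem map_jumpChain_pathLaw (x : S) :
    (pathLaw K x).map jumpChain = pathLaw (jumpKernel K) x := by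
  have hJ := measurable_jumpChain (S := S)
  have : ∀ x, IsProbabilityMeasure ((pathLaw K x).map (jumpChain (S := S))) := fun x =>
    Measure.isProbabilityMeasure_map hJ.aemeasurable
  refine eq_pathLaw_of_firstStep (jumpKernel K)
    (η := fun x => (pathLaw K x).map (jumpChain (S := S))) (fun x F hF => ?_) x
  have hG : Measurable fun ω => F (consPath x (jumpChain ω)) :=
    hF.comp ((measurable_consPath_right x).comp hJ)
  have hmap : ∀ y, ∫⁻ ω, F (consPath x ω) ∂((pathLaw K y).map jumpChain) =
      ∫⁻ ω, F (consPath x (jumpChain ω)) ∂(pathLaw K y) := fun y =>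
    lintegral_map (hF.comp (measurable_consPath_right x)) hJ
  simp only [hmap]
  rw [lintegral_map hF hJ, ← lintegral_regeneration_univ K hG x]
  refine lintegral_congr_ae ?_
  filter_upwards [ae_zero_pathLaw K x] with ω hω
  rw [jumpChain_eq_consPath ω, hω]

/-- In integrals against functions of the jump chain, the holding times may be replaced by
independent geometric variables whose parameters are read off from the jump chain; this follows by
regenerating block after block. -/
theorem lintegral_jumpChain_holdingTime (k : ℕ) (B : ℕ → Set ℕ) {F : (ℕ → S) → ℝ≥0∞}
    (hF : Measurable F) (x : S) :
    ∫⁻ ω, F (jumpChain ω) * ∏ j ∈ Finset.range k, (B j).indicator 1 (holdingTime ω j)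
        ∂(pathLaw K x) =
      ∫⁻ ω, F ω * ∏ j ∈ Finset.range k, geometricMass (leave K (ω j)) (B j)
        ∂(pathLaw (jumpKernel K) x) := by
  induction k generalizing B F x with
  | zero =>
    simp only [Finset.range_zero, Finset.prod_empty, mul_one]
    rw [← map_jumpChain_pathLaw, lintegral_map hF measurable_jumpChain]
  | succ k ih =>
    have hFx : Measurable fun ω => F (consPath x ω) := hF.comp (measurable_consPath_right x)
    have hprod : Measurable fun ω : ℕ → S =>
        ∏ j ∈ Finset.range k, (B (j + 1)).indicator (1 : ℕ → ℝ≥0∞) (holdingTime ω j) :=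
      Finset.measurable_fun_prod _ fun j _ =>
        (measurable_from_top (f := (B (j + 1)).indicator (1 : ℕ → ℝ≥0∞))).comp
          (measurable_holdingTime j)
    have hgeo : ∀ k, Measurable fun ω : ℕ → S =>
        ∏ j ∈ Finset.range k, geometricMass (leave K (ω j)) (B j) := fun k =>
      Finset.measurable_fun_prod _ fun j _ =>
        (measurable_geometricMass _).comp ((measurable_leave K).comp (measurable_pi_apply j))
    have hgeo' : Measurable fun ω : ℕ → S =>
        ∏ j ∈ Finset.range k, geometricMass (leave K (ω j)) (B (j + 1)) :=
      Finset.measurable_fun_prod _ fun j _ =>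
        (measurable_geometricMass _).comp ((measurable_leave K).comp (measurable_pi_apply j))
    have hleft : ∫⁻ ω, F (jumpChain ω) *
          ∏ j ∈ Finset.range (k + 1), (B j).indicator 1 (holdingTime ω j) ∂(pathLaw K x) =
        ∫⁻ ω, (B 0).indicator 1 (waitingTime ω 0) *
          (F (consPath x (jumpChain (shiftPath (waitingTime ω 0) ω))) *
            ∏ j ∈ Finset.range k, (B (j + 1)).indicator 1
              (holdingTime (shiftPath (waitingTime ω 0) ω) j)) ∂(pathLaw K x) := by
      refine lintegral_congr_ae ?_
      filter_upwards [ae_zero_pathLaw K x] with ω hω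
      rw [Finset.prod_range_succ', jumpChain_eq_consPath ω, hω]
      simp_rw [holdingTime_succ]
      rw [show holdingTime ω 0 = waitingTime ω 0 from rfl]
      ring
    rw [hleft, lintegral_regeneration K (B 0)
      (F := fun ω => F (consPath x (jumpChain ω)) *
        ∏ j ∈ Finset.range k, (B (j + 1)).indicator 1 (holdingTime ω j))
      ((hFx.comp measurable_jumpChain).mul hprod)]
    simp_rw [ih (fun j => B (j + 1)) hFx]
    have hFg : Measurable fun ω : ℕ → S =>
        F ω * ∏ j ∈ Finset.range (k + 1), geometricMass (leave K (ω j)) (B j) :=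
      hF.mul (hgeo (k + 1))
    have hFx' : Measurable fun ω : ℕ → S =>
        F (consPath x ω) * ∏ j ∈ Finset.range k, geometricMass (leave K (ω j)) (B (j + 1)) :=
      hFx.mul hgeo'
    rw [lintegral_pathLaw (jumpKernel K) x hFg,
      ← lintegral_const_mul _ (measurable_lintegral_pathLaw _ hFx')]
    refine lintegral_congr fun y => ?_
    rw [← lintegral_const_mul _ hFx']
    refine lintegral_congr fun ω => ?_
    rw [Finset.prod_range_succ']
    simp only [consPath_succ, consPath_zero]
    ring

end Regeneration

/-! ### Invariant and reversible measures -/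

section Invariance

theorem lintegral_leave_ne_top {S : Type*} [MeasurableSpace S] (K : Kernel S S) [IsMarkovKernel K]
    (ν : Measure S) [IsProbabilityMeasure ν] : ∫⁻ x, leave K x ∂ν ≠ ∞ := by
  refine ne_top_of_le_ne_top ENNReal.one_ne_top ?_
  calc ∫⁻ x, leave K x ∂ν ≤ ∫⁻ _, 1 ∂ν := lintegral_mono fun x => leave_le_one K x
    _ = 1 := by simp

variable {S : Type*} [MeasurableSpace S] [MeasurableEq S] (K : Kernel S S)

/-- A transition into `A` is either a jump into `A`, or starts in `A` and stays put. -/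
theorem measure_eq_diff_add_indicator (x : S) (A : Set S) :
    K x A = K x (A \ {x}) + A.indicator (fun x => K x {x}) x := by
  rw [← measure_inter_add_sdiff A (measurableSet_singleton x), add_comm]
  congr 1
  by_cases h : x ∈ A
  · rw [Set.indicator_of_mem h, Set.inter_eq_self_of_subset_right (by simpa using h)]
  · rw [Set.indicator_of_notMem h, Set.inter_singleton_eq_empty.2 h, measure_empty]

variable [IsMarkovKernel K]

theorem setLIntegral_eq_diff_add (ν : Measure S) (A : Set S) {B : Set S}
    (hB : MeasurableSet B) :
    ∫⁻ x in A, K x B ∂ν = ∫⁻ x in A, K x (B \ {x}) ∂ν + ∫⁻ x in B ∩ A, K x {x} ∂ν := by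
  simp_rw [fun x => measure_eq_diff_add_indicator K x B]
  rw [lintegral_add_left (measurable_kernel_diff_singleton K hB), lintegral_indicator hB,
    Measure.restrict_restrict hB]

variable [hK : NonDegenerate K]

theorem lintegral_leave_ne_zero (ν : Measure S) [IsProbabilityMeasure ν] :
    ∫⁻ x, leave K x ∂ν ≠ 0 := by
  rw [← pos_iff_ne_zero, lintegral_pos_iff_support (measurable_leave K)]
  have : Function.support (leave K) = Set.univ :=
    Set.eq_univ_of_forall fun x => (hK.leave_pos x).ne'
  rw [this, measure_univ]
  exact one_pos

theorem isProbabilityMeasure_jumpMeasure (ν : Measure S) [IsProbabilityMeasure ν] :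
    IsProbabilityMeasure (jumpMeasure K ν) := by
  refine ⟨?_⟩
  rw [jumpMeasure, Measure.smul_apply, withDensity_apply _ MeasurableSet.univ,
    Measure.restrict_univ]
  exact ENNReal.inv_mul_cancel (lintegral_leave_ne_zero K ν) (lintegral_leave_ne_top K ν)

/-- The densities `a` of the jump measure and `1 / a` of the jump kernel cancel: up to
normalisation, the flow of the jump kernel is the flow of `K` off the diagonal. -/
theorem setLIntegral_jumpKernel_jumpMeasure (ν : Measure S) {A B : Set S} (hA : MeasurableSet A)
    (hB : MeasurableSet B) :
    ∫⁻ x in A, jumpKernel K x B ∂(jumpMeasure K ν) =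
      (∫⁻ x, leave K x ∂ν)⁻¹ * ∫⁻ x in A, K x (B \ {x}) ∂ν := by
  rw [jumpMeasure, Measure.restrict_smul, lintegral_smul_measure, smul_eq_mul,
    setLIntegral_withDensity_eq_setLIntegral_mul _ (measurable_leave K)
      (Kernel.measurable_coe _ hB) hA]
  congr 1
  refine lintegral_congr fun x => ?_
  rw [Pi.mul_apply, jumpKernel_apply K x hB]
  exact ENNReal.mul_div_cancel (hK.leave_pos x).ne' (measure_ne_top _ _)

theorem isReversible_jumpKernel {ν : Measure S} [IsProbabilityMeasure ν]
    (h : Kernel.IsReversible K ν) : Kernel.IsReversible (jumpKernel K) (jumpMeasure K ν) := by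
  intro A B hA hB
  rw [setLIntegral_jumpKernel_jumpMeasure K ν hA hB, setLIntegral_jumpKernel_jumpMeasure K ν hB hA]
  congr 1
  have hAB := h hA hB
  rw [setLIntegral_eq_diff_add K ν A hB, setLIntegral_eq_diff_add K ν B hA,
    Set.inter_comm B A] at hAB
  refine (ENNReal.add_left_inj ?_).1 hAB
  refine ne_top_of_le_ne_top (measure_ne_top ν (A ∩ B)) ?_
  calc ∫⁻ x in A ∩ B, K x {x} ∂ν ≤ ∫⁻ x in A ∩ B, 1 ∂ν := lintegral_mono fun x => prob_le_one
    _ = ν (A ∩ B) := by simp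

theorem invariant_jumpKernel {ν : Measure S} [IsProbabilityMeasure ν]
    (h : Kernel.Invariant K ν) : Kernel.Invariant (jumpKernel K) (jumpMeasure K ν) := by
  ext A hA
  have hν : ∫⁻ x, K x A ∂ν = ν A := by
    conv_rhs => rw [← h.def, Measure.bind_apply hA (Kernel.measurable K).aemeasurable]
  have hsplit := setLIntegral_eq_diff_add K ν Set.univ hA
  have hleave : ν A = ∫⁻ x in A, leave K x ∂ν + ∫⁻ x in A, K x {x} ∂ν := by
    rw [← lintegral_add_left (measurable_leave K)]
    have : ∀ x, leave K x + K x {x} = 1 := fun x => by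
      rw [add_comm, leave, prob_add_prob_compl (measurableSet_singleton x)]
    simp [this]
  rw [Set.inter_univ, Measure.restrict_univ, hν, hleave] at hsplit
  have hfin : ∫⁻ x in A, K x {x} ∂ν ≠ ∞ := by
    refine ne_top_of_le_ne_top (measure_ne_top ν A) ?_
    rw [hleave]
    exact le_add_self
  have heq := (ENNReal.add_left_inj hfin).1 hsplit
  have hflow := setLIntegral_jumpKernel_jumpMeasure K ν MeasurableSet.univ hA
  rw [Measure.restrict_univ, Measure.restrict_univ, ← heq] at hflow
  rw [Measure.bind_apply hA (Kernel.measurable _).aemeasurable, hflow, jumpMeasure,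
    Measure.smul_apply, withDensity_apply _ hA, smul_eq_mul]

end Invariance

/-! ### Irreducibility and Harris recurrence -/

section Recurrence

variable {S : Type*} [MeasurableSpace S] [MeasurableEq S] (K : Kernel S S) [IsMarkovKernel K]

theorem pathLaw_apply_eq_pow (n : ℕ) (x : S) {A : Set S} (hA : MeasurableSet A) :
    pathLaw K x {ω | ω n ∈ A} = (K ^ n) x A := by
  have hm : ∀ n : ℕ, MeasurableSet {ω : ℕ → S | ω n ∈ A} := fun n => measurable_pi_apply n hA
  induction n generalizing x with
  | zero =>
    rw [pow_zero, show (1 : Kernel S S) = Kernel.id from rfl, Kernel.id_apply, ← map_zero_pathLaw K,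
      Measure.map_apply (measurable_pi_apply 0) hA]
    rfl
  | succ n ih =>
    rw [add_comm n 1, Kernel.pow_add_apply_eq_lintegral K 1 n x hA, pow_one,
      ← lintegral_indicator_one (hm _),
      lintegral_pathLaw K x (measurable_one.indicator (hm _))]
    refine lintegral_congr fun y => ?_
    rw [← ih, ← lintegral_indicator_one (hm _)]
    refine lintegral_congr fun ω => Set.indicator_eq_indicator ?_ rfl
    rw [Set.mem_ofPred_eq, Set.mem_ofPred_eq, add_comm 1 n, consPath_succ]

/-- Accessibility of a set, expressed through the law of the chain on path space. -/
theorem exists_pow_pos_iff (x : S) {A : Set S} (hA : MeasurableSet A) :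
    (∃ n, (K ^ n) x A > 0) ↔ 0 < pathLaw K x {ω | ∃ n, ω n ∈ A} := by
  simp_rw [← pathLaw_apply_eq_pow K _ x hA, gt_iff_lt, pos_iff_ne_zero]
  rw [Set.ofPred_exists, Ne, measure_iUnion_null_iff, not_forall]

variable [hK : NonDegenerate K]

theorem exists_jumpKernel_pow_pos_iff (x : S) {A : Set S} (hA : MeasurableSet A) :
    (∃ n, (jumpKernel K ^ n) x A > 0) ↔ ∃ n, (K ^ n) x A > 0 := by
  have hm : MeasurableSet {ω : ℕ → S | ∃ n, ω n ∈ A} := by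
    rw [Set.ofPred_exists]
    exact MeasurableSet.iUnion fun n => measurable_pi_apply n hA
  rw [exists_pow_pos_iff K x hA, exists_pow_pos_iff _ x hA, ← map_jumpChain_pathLaw,
    Measure.map_apply measurable_jumpChain hm]
  refine iff_of_eq (congrArg _ (measure_congr ?_))
  filter_upwards [ae_allBlocksFinite K x] with ω hω
  exact propext (hω.exists_mem_iff A).symm

theorem isIrreducible_jumpKernel_iff (φ : Measure S) :
    Kernel.IsIrreducible φ (jumpKernel K) ↔ Kernel.IsIrreducible φ K := by
  rw [Kernel.isIrreducible_iff, Kernel.isIrreducible_iff]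
  exact forall_congr' fun A => forall_congr' fun hA => forall_congr' fun _ =>
    forall_congr' fun x => exists_jumpKernel_pow_pos_iff K x hA

theorem isPsiIrreducible_jumpKernel_iff :
    IsPsiIrreducible (jumpKernel K) ↔ IsPsiIrreducible K := by
  simp only [IsPsiIrreducible, isIrreducible_jumpKernel_iff]

theorem isMaximalIrreducibilityMeasure_jumpKernel_iff (ψ : Measure S) :
    IsMaximalIrreducibilityMeasure (jumpKernel K) ψ ↔ IsMaximalIrreducibilityMeasure K ψ :=
  ⟨fun h => ⟨h.1, h.2, (isIrreducible_jumpKernel_iff K ψ).1 h.3,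
      fun φ h1 h2 => h.4 φ h1 ((isIrreducible_jumpKernel_iff K φ).2 h2)⟩,
    fun h => ⟨h.1, h.2, (isIrreducible_jumpKernel_iff K ψ).2 h.3,
      fun φ h1 h2 => h.4 φ h1 ((isIrreducible_jumpKernel_iff K φ).1 h2)⟩⟩

theorem ae_frequently_jumpKernel_iff (x : S) {A : Set S} (hA : MeasurableSet A) :
    (∀ᵐ ω ∂(pathLaw (jumpKernel K) x), ∃ᶠ n in atTop, ω n ∈ A) ↔
      ∀ᵐ ω ∂(pathLaw K x), ∃ᶠ n in atTop, ω n ∈ A := by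
  have hm : MeasurableSet {ω : ℕ → S | ∃ᶠ n in atTop, ω n ∈ A} := by
    have := MeasurableSet.measurableSet_limsup (s := fun n => {ω : ℕ → S | ω n ∈ A})
      fun n => measurable_pi_apply n hA
    convert this using 1
    ext ω
    simp [mem_limsup_iff_frequently_mem]
  rw [← map_jumpChain_pathLaw, ae_map_iff measurable_jumpChain.aemeasurable hm]
  refine eventually_congr ?_
  filter_upwards [ae_allBlocksFinite K x] with ω hω
  exact (hω.frequently_mem_iff A).symm

theorem isHarrisRecurrent_jumpKernel_iff :
    IsHarrisRecurrent (jumpKernel K) ↔ IsHarrisRecurrent K := by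
  unfold IsHarrisRecurrent
  refine exists_congr fun ψ => and_congr (isMaximalIrreducibilityMeasure_jumpKernel_iff K ψ) ?_
  exact forall_congr' fun A => forall_congr' fun hA => forall_congr' fun _ => forall_congr' fun x =>
    ae_frequently_jumpKernel_iff K x hA

end Recurrence

/-! ### The jump chain and the holding times of a Markov chain -/

/-- The σ-algebra generated by the random variables `Y j` is the one generated by the path `Y`. -/
theorem iSup_comap_eq_comap_path {S Ω : Type*} [MeasurableSpace S] (Y : ℕ → Ω → S) :
    ⨆ j, MeasurableSpace.comap (Y j) inferInstance =
      MeasurableSpace.comap (fun ω j => Y j ω) MeasurableSpace.pi := by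
  simp only [MeasurableSpace.pi, MeasurableSpace.comap_iSup, MeasurableSpace.comap_comp]
  rfl

section MarkovProcess

variable {S Ω : Type*} [MeasurableSpace S] [MeasurableEq S] [MeasurableSpace Ω]
  {P : Measure Ω} [IsProbabilityMeasure P] {K : Kernel S S} [IsMarkovKernel K]
  [hK : NonDegenerate K] {X : ℕ → Ω → S}

theorem IsMarkovChain.ae_allBlocksFinite (hX : IsMarkovChain X K P) :
    ∀ᵐ ω ∂P, AllBlocksFinite fun n => X n ω := by
  have hXm := hX.measurable
  have h : ∀ᵐ x ∂(P.map fun ω n => X n ω), AllBlocksFinite x := by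
    rw [hX.map_eq_chainLaw, chainLaw]
    refine (Measure.ae_comp_iff (κ := ⟨pathLaw K, measurable_pathLaw K⟩) ?_).2
      (Eventually.of_forall fun x => JumpChain.ae_allBlocksFinite K x)
    have : {x : ℕ → S | AllBlocksFinite x} = ⋂ k, {x | holdingTime x k = 0}ᶜ := by
      ext x
      simp [AllBlocksFinite, holdingTime]
    rw [this]
    exact MeasurableSet.iInter fun k =>
      (measurable_holdingTime k (measurableSet_singleton 0)).compl
  exact ae_of_ae_map (by fun_prop) h

/-- The jump chain of a Markov chain is a Markov chain. -/
theorem IsMarkovChain.isMarkovChain_jumpChain (hX : IsMarkovChain X K P) :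
    IsMarkovChain (fun k ω => jumpChain (fun n => X n ω) k) (jumpKernel K) P := by
  have hXm := hX.measurable
  have hXp : Measurable fun ω n => X n ω := by fun_prop
  have hJ := measurable_jumpChain (S := S)
  have := Measure.isProbabilityMeasure_map (μ := P) (hX.measurable 0).aemeasurable
  refine isMarkovChain_of_map_eq_chainLaw (μ := P.map (X 0))
    (fun k => (measurable_pi_apply k).comp (hJ.comp hXp)) ?_
  have h : P.map (fun ω => jumpChain fun n => X n ω) =
      (P.map fun ω n => X n ω).map jumpChain := (Measure.map_map hJ hXp).symm
  refine h.trans ?_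
  rw [hX.map_eq_chainLaw]
  ext A hA
  rw [Measure.map_apply hJ hA, chainLaw, chainLaw,
    Measure.bind_apply (hJ hA) (measurable_pathLaw K).aemeasurable,
    Measure.bind_apply hA (measurable_pathLaw _).aemeasurable]
  refine lintegral_congr fun x => ?_
  rw [← map_jumpChain_pathLaw, Measure.map_apply hJ hA]

theorem IsMarkovChain.lintegral_jumpChain_holdingTime (hX : IsMarkovChain X K P) (k : ℕ)
    (B : ℕ → Set ℕ) {F : (ℕ → S) → ℝ≥0∞} (hF : Measurable F) :
    ∫⁻ ω, F (jumpChain fun n => X n ω) *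
        ∏ j ∈ Finset.range k, (B j).indicator 1 (holdingTime (fun n => X n ω) j) ∂P =
      ∫⁻ ω, F (jumpChain fun n => X n ω) * ∏ j ∈ Finset.range k,
        geometricMass (leave K (jumpChain (fun n => X n ω) j)) (B j) ∂P := by
  have hXm := hX.measurable
  have hXp : Measurable fun ω n => X n ω := by fun_prop
  have hJ := measurable_jumpChain (S := S)
  have hprod : Measurable fun x : ℕ → S => F (jumpChain x) *
      ∏ j ∈ Finset.range k, (B j).indicator (1 : ℕ → ℝ≥0∞) (holdingTime x j) :=
    (hF.comp hJ).mul (Finset.measurable_fun_prod _ fun j _ =>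
      (measurable_from_top (f := (B j).indicator (1 : ℕ → ℝ≥0∞))).comp (measurable_holdingTime j))
  have hgeo : Measurable fun y : ℕ → S =>
      F y * ∏ j ∈ Finset.range k, geometricMass (leave K (y j)) (B j) :=
    hF.mul (Finset.measurable_fun_prod _ fun j _ =>
      (measurable_geometricMass _).comp ((measurable_leave K).comp (measurable_pi_apply j)))
  have hgeoJ : Measurable fun x : ℕ → S => F (jumpChain x) * ∏ j ∈ Finset.range k,
      geometricMass (leave K (jumpChain x j)) (B j) := hgeo.comp hJ
  rw [← lintegral_map (f := fun x => F (jumpChain x) *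
      ∏ j ∈ Finset.range k, (B j).indicator (1 : ℕ → ℝ≥0∞) (holdingTime x j)) hprod hXp,
    ← lintegral_map (f := fun x => F (jumpChain x) * ∏ j ∈ Finset.range k,
      geometricMass (leave K (jumpChain x j)) (B j)) hgeoJ hXp,
    hX.map_eq_chainLaw, lintegral_chainLaw K _ hprod, lintegral_chainLaw K _ hgeoJ]
  refine lintegral_congr fun x => ?_
  rw [JumpChain.lintegral_jumpChain_holdingTime K k B hF x, ← map_jumpChain_pathLaw,
    lintegral_map hgeo hJ]

/-- The conditional joint law of the holding times given the jump chain is a product of geometric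
laws. -/
theorem IsMarkovChain.condProb_holdingTime (hX : IsMarkovChain X K P) (s : Finset ℕ)
    (B : ℕ → Set ℕ) :
    P⟦⋂ i ∈ s, (fun ω => holdingTime (fun n => X n ω) i) ⁻¹' B i |
        MeasurableSpace.comap (fun ω => jumpChain fun n => X n ω) MeasurableSpace.pi⟧
      =ᵐ[P] fun ω => ∏ i ∈ s,
        (geometricMass (leave K (jumpChain (fun n => X n ω) i)) (B i)).toReal := by
  classical
  have hXm := hX.measurable
  have hXp : Measurable fun ω n => X n ω := by fun_prop
  have hJ : Measurable fun ω => jumpChain fun n => X n ω := measurable_jumpChain.comp hXp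
  have hm := hJ.comap_le
  set E : Set Ω := ⋂ i ∈ s, (fun ω => holdingTime (fun n => X n ω) i) ⁻¹' B i with hE
  have hEm : MeasurableSet E := Finset.measurableSet_biInter s fun i _ =>
    (measurable_holdingTime i).comp hXp (MeasurableSet.of_discrete (s := B i))
  let g : (ℕ → S) → ℝ≥0∞ := fun y => ∏ i ∈ s, geometricMass (leave K (y i)) (B i)
  have hg : Measurable g := Finset.measurable_fun_prod _ fun j _ =>
    (measurable_geometricMass _).comp ((measurable_leave K).comp (measurable_pi_apply j))
  have hgJ : Measurable fun ω => g (jumpChain fun n => X n ω) := hg.comp hJ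
  have hg1 : ∀ y, g y ≤ 1 := fun y => Finset.prod_le_one' fun i _ =>
    geometricMass_le_one (hK.leave_pos _).ne' (leave_le_one K _) _
  have hgr : (fun ω => ∏ i ∈ s,
      (geometricMass (leave K (jumpChain (fun n => X n ω) i)) (B i)).toReal) =
      fun ω => (g (jumpChain fun n => X n ω)).toReal :=
    funext fun ω => (ENNReal.toReal_prod _ _).symm
  rw [hgr]
  have hgi : Integrable (fun ω => (g (jumpChain fun n => X n ω)).toReal) P := by
    refine Integrable.of_bound hgJ.ennreal_toReal.aestronglyMeasurable 1
      (Eventually.of_forall fun ω => ?_)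
    rw [Real.norm_of_nonneg ENNReal.toReal_nonneg]
    exact ENNReal.toReal_le_of_le_ofReal zero_le_one (by simpa using hg1 _)
  refine (ae_eq_condExp_of_forall_setIntegral_eq hm
    ((integrable_const (1 : ℝ)).indicator hEm) (fun t _ _ => hgi.integrableOn) ?_ ?_).symm
  · rintro t ⟨A, hA, rfl⟩ -
    have htm := hJ hA
    -- extend the events by the trivial ones off `s`, to cover an initial segment of indices
    let B' : ℕ → Set ℕ := fun j => if j ∈ s then B j else Set.univ
    have hsub : s ⊆ Finset.range (s.sup id + 1) := fun i hi =>
      Finset.mem_range.2 (Nat.lt_succ_of_le (Finset.le_sup (f := id) hi))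
    have h := hX.lintegral_jumpChain_holdingTime (s.sup id + 1) B'
      (F := A.indicator 1) (measurable_one.indicator hA)
    have hl : ∀ ω, ∏ j ∈ Finset.range (s.sup id + 1),
        (B' j).indicator (1 : ℕ → ℝ≥0∞) (holdingTime (fun n => X n ω) j) = E.indicator 1 ω := by
      intro ω
      rw [← Finset.prod_subset hsub fun j _ hj => by simp [B', hj]]
      rw [Finset.prod_congr rfl fun j hj => by rw [show B' j = B j by simp [B', hj]]]
      by_cases hω : ω ∈ E
      · rw [Set.indicator_of_mem hω]
        refine Finset.prod_eq_one fun j hj => ?_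
        rw [Set.indicator_of_mem]
        · rfl
        · exact Set.mem_iInter₂.1 hω j hj
      · rw [Set.indicator_of_notMem hω]
        simp only [hE, Set.mem_iInter, not_forall] at hω
        obtain ⟨j, hj, hjB⟩ := hω
        exact Finset.prod_eq_zero hj (Set.indicator_of_notMem (s := B j) hjB _)
    have hr : ∀ y : ℕ → S, ∏ j ∈ Finset.range (s.sup id + 1),
        geometricMass (leave K (y j)) (B' j) = g y := by
      intro y
      rw [← Finset.prod_subset hsub fun j _ hj => by
        simpa [B', hj] using geometricMass_univ (hK.leave_pos (y j)).ne' (leave_le_one K _)]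
      exact Finset.prod_congr rfl fun j hj => by rw [show B' j = B j by simp [B', hj]]
    simp only [hl, hr] at h
    have hset : ∀ f : Ω → ℝ≥0∞, ∫⁻ ω, A.indicator 1 (jumpChain fun n => X n ω) * f ω ∂P =
        ∫⁻ ω in (fun ω => jumpChain fun n => X n ω) ⁻¹' A, f ω ∂P := by
      intro f
      rw [← lintegral_indicator htm]
      refine lintegral_congr fun ω => ?_
      by_cases hω : ω ∈ (fun ω => jumpChain fun n => X n ω) ⁻¹' A
      · rw [Set.indicator_of_mem hω, Set.indicator_of_mem (Set.mem_preimage.1 hω), Pi.one_apply,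
          one_mul]
      · rw [Set.indicator_of_notMem hω, Set.indicator_of_notMem (s := A) hω, zero_mul]
    rw [hset, hset, lintegral_indicator_one hEm] at h
    rw [integral_indicator_const _ hEm, smul_eq_mul, mul_one, Measure.real, h,
      integral_toReal hgJ.aemeasurable
        (Eventually.of_forall fun ω => (hg1 _).trans_lt ENNReal.one_lt_top)]
  · exact ((hg.comp (comap_measurable _)).ennreal_toReal).aestronglyMeasurable

theorem IsMarkovChain.condProb_holdingTime_preimage (hX : IsMarkovChain X K P) (k : ℕ)
    (B : Set ℕ) :
    P⟦(fun ω => holdingTime (fun n => X n ω) k) ⁻¹' B |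
        MeasurableSpace.comap (fun ω => jumpChain fun n => X n ω) MeasurableSpace.pi⟧
      =ᵐ[P] fun ω =>
        (geometricMass (leave K (jumpChain (fun n => X n ω) k)) B).toReal := by
  simpa using hX.condProb_holdingTime {k} fun _ => B

end MarkovProcess

end JumpChain

theorem propositionC1 {S Ω : Type*} [MeasurableSpace S] [MeasurableEq S] [MeasurableSpace Ω]
    (P : Measure Ω) [IsProbabilityMeasure P]
    (K : Kernel S S) [IsMarkovKernel K] [NonDegenerate K]
    (X : ℕ → Ω → S) (hX : IsMarkovChain X K P)
    (Y : ℕ → Ω → S) (hY : ∀ k ω, Y k ω = jumpChain (fun n => X n ω) k)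
    (N : ℕ → Ω → ℕ) (hN : ∀ k ω, N k ω = holdingTime (fun n => X n ω) k) :
    -- almost surely, every holding time is finite
    (∀ᵐ ω ∂P, ∀ k, ∃ j ≥ 1,
      X (jumpTime (fun n => X n ω) k + j) ω ≠ X (jumpTime (fun n => X n ω) k) ω) ∧
    -- the jump chain is Markov with the jump kernel
    IsMarkovChain Y (jumpKernel K) P ∧
    -- the holding times are conditionally independent geometric given the whole jump chain
    (IsCondIndep N P (⨆ j, MeasurableSpace.comap (Y j) inferInstance) ∧
      ∀ k, ∀ n ≥ 1,
        P⟦N k ⁻¹' {n} | ⨆ j, MeasurableSpace.comap (Y j) inferInstance⟧ =ᵐ[P]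
          fun ω => (1 - (leave K (Y k ω)).toReal) ^ (n - 1) * (leave K (Y k ω)).toReal) ∧
    -- invariance and reversibility
    (∀ ν : Measure S, IsProbabilityMeasure ν →
      (Kernel.Invariant K ν →
        IsProbabilityMeasure (jumpMeasure K ν) ∧
          Kernel.Invariant (jumpKernel K) (jumpMeasure K ν)) ∧
      (Kernel.IsReversible K ν → Kernel.IsReversible (jumpKernel K) (jumpMeasure K ν))) ∧
    -- irreducibility, with the same maximal irreducibility measures
    ((IsPsiIrreducible K ↔ IsPsiIrreducible (jumpKernel K)) ∧
      ∀ ψ : Measure S, IsMaximalIrreducibilityMeasure K ψ ↔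
        IsMaximalIrreducibilityMeasure (jumpKernel K) ψ) ∧
    -- Harris recurrence
    (IsHarrisRecurrent K ↔ IsHarrisRecurrent (jumpKernel K)) := by
  have hXm := hX.measurable
  obtain rfl : Y = fun k ω => jumpChain (fun n => X n ω) k := funext fun k => funext (hY k)
  obtain rfl : N = fun k ω => holdingTime (fun n => X n ω) k := funext fun k => funext (hN k)
  rw [iSup_comap_eq_comap_path]
  refine ⟨?_, hX.isMarkovChain_jumpChain, ⟨fun s B _ => ?_, fun k n hn => ?_⟩, fun ν _ => ⟨fun h =>
    ⟨isProbabilityMeasure_jumpMeasure K ν, invariant_jumpKernel K h⟩, isReversible_jumpKernel K⟩,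
    ⟨(isPsiIrreducible_jumpKernel_iff K).symm,
      fun ψ => (isMaximalIrreducibilityMeasure_jumpKernel_iff K ψ).symm⟩,
    (isHarrisRecurrent_jumpKernel_iff K).symm⟩
  · filter_upwards [hX.ae_allBlocksFinite] with ω hω k
    exact exists_ne_of_waitingTime_ne_zero (hω k)
  · have hi : ∀ᵐ ω ∂P, ∀ i ∈ s, (P⟦(fun ω => holdingTime (fun n => X n ω) i) ⁻¹' B i |
        MeasurableSpace.comap (fun ω => jumpChain fun n => X n ω) MeasurableSpace.pi⟧) ω =
        (geometricMass (leave K (jumpChain (fun n => X n ω) i)) (B i)).toReal :=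
      (ae_ball_iff s.countable_toSet).2 fun i _ => hX.condProb_holdingTime_preimage i (B i)
    filter_upwards [hX.condProb_holdingTime s B, hi] with ω h1 h2
    rw [Finset.prod_congr rfl h2]
    exact h1
  · obtain ⟨n, rfl⟩ := Nat.exists_eq_add_of_le' hn
    filter_upwards [hX.condProb_holdingTime_preimage k {n + 1}] with ω hω
    refine hω.trans ?_
    rw [geometricMass_singleton, ENNReal.toReal_mul, ENNReal.toReal_pow,
      ENNReal.toReal_sub_of_le (leave_le_one K _) ENNReal.one_ne_top, ENNReal.toReal_one,
      Nat.add_sub_cancel]
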